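/- A digraph is finite, without loops and multiple arcs. For a real number $\alpha$ with $0\le\alpha<1$ and a digraph $G$ let $A_\alpha(G)=\alpha D(G)+(1-\alpha)A(G)$, where $A(G)$ is the adjacency matrix of $G$ and $D(G)$ is the diagonal matrix of its outdegrees; the $\alpha$-spectral radius $\rho_\alpha(G)$ is the spectral radius of $A_\alpha(G)$ (the largest modulus of an eigenvalue). For $t\ge 1$ let $\widetilde S^t_m$ be the set of integer sequences $(x_1,\dots,x_t)$ with $x_1\ge x_2\ge\dots\ge x_t\ge 1$, $\sum_{i=1}^t x_i=m$ and, if $t\ge 2$, $x_{t-1}\ge 2$. For $K=(k_1,\dots,k_s)\in\widetilde S^s_{m_1}$ and $L=(l_1,\dots,l_t)\in\widetilde S^t_{m_2}$ let $\widetilde\Theta(K,L)$ be the digraph with $m_1+m_2$ arcs obtained from two distinct vertices $u,v$ by adding $s$ directed paths of lengths $k_1,\dots,k_s$ from $u$ to $v$ and $t$ directed paths of lengths $l_1,\dots,l_t$ from $v$ to $u$, all of them pairwise internally disjoint. Let ${}^s_t\widetilde{\boldsymbol\Theta}(m)$ be the set of all $\widetilde\Theta(K,L)$ with $K\in\widetilde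 S^s_{m_1}$, $L\in\widetilde S^t_{m_2}$ and $m_1+m_2=m$. Put $\zeta_t=(2,\dots,2,1)$ ($t$ entries, $t-1$ of them equal to $2$), $\zeta^m_t=(m-2t+3,2,\dots,2,1)$ ($t$ entries, $t-2$ of them equal to $2$ between the first and the last) for $t\ge 2$ and $m\ge 2t-1$, and $\zeta^m_1=(m)$ for $m\ge 1$. Theorem. Let $0\le\alpha<1$, $s\ge t\ge 1$, $k=s+t$ and $m\ge 2k-2$. Then: (1) $\widetilde\Theta(\zeta^{m-2t+1}_s,\zeta_t)$ is, up to isomorphism, the unique digraph with the maximal $\alpha$-spectral radius in ${}^s_t\widetilde{\boldsymbol\Theta}(m)$: it belongs to this set, no digraph in the set has a larger $\alpha$-spectral radius, and each digraph in the set with the same $\alpha$-spectral radius is isomorphic to it. (2) If $t=1$, then, in the same sense, $\widetilde\Theta\bigl(\zeta_{k-1},(m-2k+3)\bigr)$ is, up to isomorphism, the unique digraph with the minimal $\alpha$-spectral radius in ${}^s_1\widetilde{\boldsymbol\Theta}(m)$. Here the forward paths have lengths $2,\dots,2,1$ and the single backward path has length $m-2k+3$. -/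

import Mathlib

universe w

/-- The spectral radius of a real square matrix: the largest modulus of a complex eigenvalue.
(For a matrix over a finite index type this supremum is finite.) -/
noncomputable def matrixSpectralRadius {V : Type*} [Fintype V] (M : Matrix V V ℝ) : ENNReal :=
  letI := Classical.decEq V
  spectralRadius ℂ (M.map (algebraMap ℝ ℂ))

/-- The adjacency matrix of a digraph. -/
noncomputable def digraphAdjMatrix {V : Type*} (G : Digraph V) : Matrix V V ℝ :=
  open Classical in
  Matrix.of fun x y => if G.Adj x y then 1 else 0

/-- The outdegree of a vertex: the number of its out-neighbours. -/
noncomputable def digraphOutDegree {V : Type*} (G : Digraph V) (x : V) : ℕ :=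
  Set.ncard {y : V | G.Adj x y}

/-- The matrix `A_α(G) = α D(G) + (1 - α) A(G)`, where `D(G)` is the diagonal matrix of the
outdegrees. -/
noncomputable def alphaMatrix {V : Type*} (α : ℝ) (G : Digraph V) : Matrix V V ℝ :=
  letI := Classical.decEq V
  α • Matrix.diagonal (fun x => (digraphOutDegree G x : ℝ)) + (1 - α) • digraphAdjMatrix G

/-- The `α`-spectral radius `ρ_α(G)`. -/
noncomputable def alphaSpectralRadius {V : Type*} [Fintype V] (α : ℝ) (G : Digraph V) : ENNReal :=
  matrixSpectralRadius (alphaMatrix α G)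

/-- Two digraphs are isomorphic. -/
def DigraphIso {V W : Type*} (G : Digraph V) (H : Digraph W) : Prop :=
  Nonempty (G.Adj ≃r H.Adj)

/-- The set of sequences `x₁ ≥ x₂ ≥ … ≥ x_t ≥ 1` of integers with sum `m` and `x_{t-1} ≥ 2`
(no condition of the last kind if `t = 1`). The entry `x_i` of the text is `x (i - 1)` here. -/
def thetaSeq (t m : ℕ) : Set (Fin t → ℕ) :=
  {x | Antitone x ∧ (∀ i, 1 ≤ x i) ∧ ∑ i, x i = m ∧ ∀ i : Fin t, (i : ℕ) + 2 = t → 2 ≤ x i}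

/-- `ζ_t = (2, …, 2, 1)`, of length `t`. -/
def zeta (t : ℕ) : Fin t → ℕ :=
  fun i => if (i : ℕ) + 1 = t then 1 else 2

/-- `ζ^m_t = (m - 2t + 3, 2, …, 2, 1)` of length `t` for `t ≥ 2`, and `ζ^m_1 = (m)`.
It is used for `m ≥ 2t - 1`. -/
def zetaTop (t m : ℕ) : Fin t → ℕ :=
  fun i =>
    if t = 1 then m
    else if (i : ℕ) = 0 then m + 3 - 2 * t
    else if (i : ℕ) + 1 = t then 1
    else 2

/-- The vertices of `Θ̃(K, L)`: the vertex `u` (`false`), the vertex `v` (`true`), the `K i - 1`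
inner vertices of the `i`-th forward path and the `L j - 1` inner vertices of the `j`-th
backward path. -/
abbrev ThetaVertex {s t : ℕ} (K : Fin s → ℕ) (L : Fin t → ℕ) : Type :=
  Bool ⊕ ((Σ i : Fin s, Fin (K i - 1)) ⊕ (Σ j : Fin t, Fin (L j - 1)))

/-- The `p`-th vertex, `0 ≤ p ≤ K i`, of the `i`-th forward path, which leads from `u` to `v`. -/
def thetaForward {s t : ℕ} (K : Fin s → ℕ) (L : Fin t → ℕ) (i : Fin s) (p : ℕ) :
    ThetaVertex K L :=
  if h0 : p = 0 then Sum.inl false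
  else if h : p < K i then Sum.inr (Sum.inl ⟨i, ⟨p - 1, by omega⟩⟩)
  else Sum.inl true

/-- The `q`-th vertex, `0 ≤ q ≤ L j`, of the `j`-th backward path, which leads from `v` to `u`. -/
def thetaBackward {s t : ℕ} (K : Fin s → ℕ) (L : Fin t → ℕ) (j : Fin t) (q : ℕ) :
    ThetaVertex K L :=
  if h0 : q = 0 then Sum.inl true
  else if h : q < L j then Sum.inr (Sum.inr ⟨j, ⟨q - 1, by omega⟩⟩)
  else Sum.inl false

/-- The digraph `Θ̃(K, L)`: internally disjoint directed paths of lengths `K i` from `u` to `v`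
and of lengths `L j` from `v` to `u`. -/
def thetaDigraph {s t : ℕ} (K : Fin s → ℕ) (L : Fin t → ℕ) : Digraph (ThetaVertex K L) where
  Adj x y :=
    (∃ i : Fin s, ∃ p < K i, x = thetaForward K L i p ∧ y = thetaForward K L i (p + 1)) ∨
    (∃ j : Fin t, ∃ q < L j, x = thetaBackward K L j q ∧ y = thetaBackward K L j (q + 1))

/-- `G` is, up to isomorphism, a generalized theta digraph of size `m` with `s` forward and `t`
backward paths. -/
def IsThetaDigraph (s t m : ℕ) {V : Type*} (G : Digraph V) : Prop :=
  ∃ m₁ m₂ : ℕ, m₁ + m₂ = m ∧ ∃ K ∈ thetaSeq s m₁, ∃ L ∈ thetaSeq t m₂,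
    DigraphIso G (thetaDigraph K L)

/-- `G₀` is, up to isomorphism, the unique digraph with maximal `α`-spectral radius among the
generalized theta digraphs of size `m` with `s` forward and `t` backward paths. -/
def IsUniqueThetaMaximizer (α : ℝ) (s t m : ℕ) {W : Type} [Fintype W]
    (G₀ : Digraph W) : Prop :=
  IsThetaDigraph s t m G₀ ∧
    ∀ {V : Type w} [Fintype V] (G : Digraph V), IsThetaDigraph s t m G →
      alphaSpectralRadius α G ≤ alphaSpectralRadius α G₀ ∧
      (alphaSpectralRadius α G = alphaSpectralRadius α G₀ → DigraphIso G G₀)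

/-- `G₀` is, up to isomorphism, the unique digraph with minimal `α`-spectral radius among the
generalized theta digraphs of size `m` with `s` forward and `t` backward paths. -/
def IsUniqueThetaMinimizer (α : ℝ) (s t m : ℕ) {W : Type} [Fintype W]
    (G₀ : Digraph W) : Prop :=
  IsThetaDigraph s t m G₀ ∧
    ∀ {V : Type w} [Fintype V] (G : Digraph V), IsThetaDigraph s t m G →
      alphaSpectralRadius α G₀ ≤ alphaSpectralRadius α G ∧
      (alphaSpectralRadius α G = alphaSpectralRadius α G₀ → DigraphIso G G₀)

/-! The problem reduces to comparing polynomials. An inner vertex of a path has outdegree one, so an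
eigenvector for `ρ` is multiplied by `r = (1 - α) / (ρ - α)` at each step away from the end of the
path. Eliminating the inner vertices leaves two equations, at `u` and `v`. They have a positive
solution when `((1 - α) - α (s - 1) r) ((1 - α) - α (t - 1) r) = (1 - α)² P_K(r) P_L(r)` with both
left factors positive, where `P_K(r) = ∑ r ^ K i` (`IsThetaRoot.alphaSpectralRadius_eq`). Where both
factors are positive the left side does not increase with `r`, while the right side strictly
increases. Hence a larger product `P_K P_L` on `(0, 1)` means a smaller root and a larger spectral
radius (`alphaSpectralRadius_thetaDigraph_compare`).

Every admissible sequence is `zeta` plus a nonnegative excess, and the total excess is fixed by `m`.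
Since `1 - r ^ a` is subadditive in `a`, a path polynomial is largest when its excess sits in one
entry (`sum_pow_le_sum_pow_zetaTop`). The product grows further when the excess of `L` is moved to
the side with at least as many paths (`sum_pow_mul_sum_pow_le_of_two_le`,
`sum_pow_mul_sum_pow_le_of_one`). For `t = 1` the product is smallest when the single backward path
takes all the excess, because that raises every exponent at once (`sum_pow_zeta_mul_le`). For `s = t
= 1` every digraph of the class is a directed `m`-cycle. -/

/-! ### Spectral radius from a positive eigenvector. -/

/-- The easy half of Perron–Frobenius: positivity of the eigenvector replaces irreducibility. -/
theorem matrixSpectralRadius_eq_of_pos_eigenvector {V : Type*} [Fintype V] [Nonempty V]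
    {M : Matrix V V ℝ} (hM : ∀ i j, 0 ≤ M i j) {x : V → ℝ} (hx : ∀ i, 0 < x i) {c : ℝ}
    (h : ∀ i, ∑ j, M i j * x j = c * x i) :
    matrixSpectralRadius M = ENNReal.ofReal c := by
  classical
  have key : ∀ k : ℂ, k ∈ spectrum ℂ (M.map (algebraMap ℝ ℂ)) ↔
      ∃ z : V → ℂ, z ≠ 0 ∧ ∀ i, ∑ j, (M i j : ℂ) * z j = k * z i := by
    intro k
    rw [← Matrix.spectrum_toLin', ← Module.End.hasEigenvalue_iff_mem_spectrum]
    constructor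
    · intro hk
      obtain ⟨z, hz⟩ := hk.exists_hasEigenvector
      refine ⟨z, hz.2, fun i => ?_⟩
      have := congrFun hz.apply_eq_smul i
      simpa [Matrix.toLin'_apply, Matrix.mulVec, dotProduct] using this
    · rintro ⟨z, hz, hz'⟩
      refine Module.End.hasEigenvalue_of_hasEigenvector (x := z) ⟨?_, hz⟩
      rw [Module.End.mem_eigenspace_iff]
      ext i
      simpa [Matrix.toLin'_apply, Matrix.mulVec, dotProduct] using hz' i
  unfold matrixSpectralRadius spectralRadius
  apply le_antisymm
  · refine iSup₂_le fun k hk => ?_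
    obtain ⟨z, hz, hz'⟩ := (key k).1 (by convert hk)
    -- At an index maximizing `‖z i‖ / x i`, the triangle inequality in row `i` gives `‖k‖ ≤ c`.
    obtain ⟨i, hi⟩ := Finite.exists_max fun i => ‖z i‖ / x i
    have hzi : 0 < ‖z i‖ := by
      obtain ⟨j, hj⟩ := Function.ne_iff.1 hz
      have h1 : 0 < ‖z j‖ / x j := div_pos (norm_pos_iff.2 hj) (hx j)
      have h2 := h1.trans_le (hi j)
      by_contra h0
      have : ‖z i‖ = 0 := le_antisymm (not_lt.1 h0) (norm_nonneg _)
      simp [this] at h2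
    have hle : ‖k‖ * ‖z i‖ ≤ c * ‖z i‖ := by
      calc ‖k‖ * ‖z i‖ = ‖∑ j, (M i j : ℂ) * z j‖ := by rw [hz' i, norm_mul]
        _ ≤ ∑ j, ‖(M i j : ℂ) * z j‖ := norm_sum_le _ _
        _ ≤ ∑ j, M i j * x j * (‖z i‖ / x i) := by
            refine Finset.sum_le_sum fun j _ => ?_
            rw [norm_mul, Complex.norm_real, Real.norm_of_nonneg (hM i j), mul_assoc]
            refine mul_le_mul_of_nonneg_left ?_ (hM i j)
            have := hi j
            rw [div_le_iff₀ (hx j)] at this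
            linarith
        _ = c * ‖z i‖ := by
            rw [← Finset.sum_mul, h i]
            field_simp [(hx i).ne']
    have hkc := le_of_mul_le_mul_right hle hzi
    rw [← ENNReal.ofReal_coe_nnreal]
    exact ENNReal.ofReal_le_ofReal hkc
  · have hc : (c : ℂ) ∈ spectrum ℂ (M.map (algebraMap ℝ ℂ)) := by
      refine (key c).2 ⟨fun i => (x i : ℂ), ?_, fun i => ?_⟩
      · obtain ⟨i⟩ := ‹Nonempty V›
        exact Function.ne_iff.2 ⟨i, by simpa using (hx i).ne'⟩
      · beta_reduce
        exact_mod_cast h i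
    refine le_trans ?_ (le_iSup₂ (c : ℂ) (by convert hc))
    rw [← ENNReal.ofReal_coe_nnreal]
    refine ENNReal.ofReal_le_ofReal ?_
    simpa using le_abs_self c

/-! ### Isomorphism invariance and the rows of `alphaMatrix`. -/

theorem DigraphIso.refl {V : Type*} (G : Digraph V) : DigraphIso G G := ⟨RelIso.refl _⟩

theorem DigraphIso.trans {U V W : Type*} {F : Digraph U} {G : Digraph V} {H : Digraph W}
    (h₁ : DigraphIso F G) (h₂ : DigraphIso G H) : DigraphIso F H := by
  obtain ⟨e⟩ := h₁
  obtain ⟨f⟩ := h₂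
  exact ⟨e.trans f⟩

theorem digraphOutDegree_apply_relIso {V W : Type*} {G : Digraph V} {H : Digraph W}
    (e : G.Adj ≃r H.Adj) (x : V) : digraphOutDegree H (e x) = digraphOutDegree G x := by
  unfold digraphOutDegree
  rw [← Set.ncard_image_of_injective {y | G.Adj x y} e.injective]
  congr 1
  ext y
  constructor
  · intro hy
    refine ⟨e.symm y, ?_, by simp⟩
    have : H.Adj (e x) (e (e.symm y)) := by simpa using hy
    exact e.map_rel_iff.1 this
  · rintro ⟨z, hz, rfl⟩
    exact e.map_rel_iff.2 hz

theorem alphaSpectralRadius_congr {V W : Type*} [Fintype V] [Fintype W] (α : ℝ)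
    {G : Digraph V} {H : Digraph W} (h : DigraphIso G H) :
    alphaSpectralRadius α G = alphaSpectralRadius α H := by
  classical
  obtain ⟨e⟩ := h
  have hM : (alphaMatrix α H).map (algebraMap ℝ ℂ) =
      Matrix.reindexAlgEquiv ℂ ℂ e.toEquiv ((alphaMatrix α G).map (algebraMap ℝ ℂ)) := by
    ext i j
    obtain ⟨a, rfl⟩ := e.surjective i
    obtain ⟨b, rfl⟩ := e.surjective j
    have hsymm : ∀ a, e.toEquiv.symm (e a) = a := fun a => e.toEquiv.symm_apply_apply a
    simp [alphaMatrix, digraphAdjMatrix, Matrix.diagonal_apply, digraphOutDegree_apply_relIso,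
      e.map_rel_iff, hsymm]
  unfold alphaSpectralRadius matrixSpectralRadius spectralRadius
  have hs : spectrum ℂ ((alphaMatrix α H).map (algebraMap ℝ ℂ)) =
      spectrum ℂ ((alphaMatrix α G).map (algebraMap ℝ ℂ)) := by
    rw [hM, AlgEquiv.spectrum_eq]
  congr! 3 with k
  refine iff_of_eq ?_
  have := congrArg (k ∈ ·) hs.symm
  convert this

/-- Injectivity of `N` makes `ι` count the out-neighbours, so the outdegree becomes a cardinality.
-/
theorem sum_alphaMatrix_mul {V ι : Type*} [Fintype V] [Fintype ι] (α : ℝ) (G : Digraph V)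
    (a : V) (N : ι → V) (hinj : Function.Injective N) (hN : ∀ y, G.Adj a y ↔ ∃ i, y = N i)
    (x : V → ℝ) :
    ∑ j, alphaMatrix α G a j * x j =
      α * Fintype.card ι * x a + (1 - α) * ∑ i, x (N i) := by
  classical
  have hdeg : digraphOutDegree G a = Fintype.card ι := by
    have : {y | G.Adj a y} = Set.range N := by
      ext y
      simp [hN, eq_comm]
    rw [digraphOutDegree, this, Set.ncard_range_of_injective hinj, Nat.card_eq_fintype_card]
  have hsum : ∑ j, (if G.Adj a j then 1 else 0 : ℝ) * x j = ∑ i, x (N i) := by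
    rw [← Finset.sum_image (s := Finset.univ) (g := N) (f := x) (fun _ _ _ _ h => hinj h)]
    simp only [ite_mul, one_mul, zero_mul]
    rw [← Finset.sum_filter]
    refine Finset.sum_congr ?_ fun _ _ => rfl
    ext y
    simp [hN, eq_comm]
  rw [← hsum, ← hdeg, Finset.mul_sum]
  simp only [alphaMatrix, digraphAdjMatrix, Matrix.add_apply, Matrix.smul_apply, Matrix.of_apply,
    smul_eq_mul, add_mul, Finset.sum_add_distrib]
  congr 1
  · rw [Finset.sum_eq_single a] <;> simp +contextual [eq_comm]
  · exact Finset.sum_congr rfl fun j _ => mul_assoc _ _ _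

theorem alphaMatrix_nonneg {V : Type*} {α : ℝ} (h₀ : 0 ≤ α) (h₁ : α < 1) (G : Digraph V)
    (i j : V) : 0 ≤ alphaMatrix α G i j := by
  classical
  simp only [alphaMatrix, digraphAdjMatrix, Matrix.add_apply, Matrix.smul_apply, Matrix.of_apply,
    smul_eq_mul, Matrix.diagonal_apply]
  have : 0 ≤ 1 - α := by linarith
  split_ifs <;> positivity

/-! ### Arcs of the theta digraph and the weights of the eigenvector. -/

section ThetaStructure

variable {s t : ℕ} {K : Fin s → ℕ} {L : Fin t → ℕ}

theorem thetaForward_zero (i : Fin s) : thetaForward K L i 0 = Sum.inl false := by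
  simp [thetaForward]

theorem thetaBackward_zero (j : Fin t) : thetaBackward K L j 0 = Sum.inl true := by
  simp [thetaBackward]

theorem thetaForward_succ_of_lt {i : Fin s} {p : ℕ} (h : p + 1 < K i) :
    thetaForward K L i (p + 1) = Sum.inr (Sum.inl ⟨i, ⟨p, by omega⟩⟩) := by
  simp [thetaForward, h]

theorem thetaBackward_succ_of_lt {j : Fin t} {q : ℕ} (h : q + 1 < L j) :
    thetaBackward K L j (q + 1) = Sum.inr (Sum.inr ⟨j, ⟨q, by omega⟩⟩) := by
  simp [thetaBackward, h]

theorem thetaForward_succ_of_le {i : Fin s} {p : ℕ} (h : K i ≤ p + 1) :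
    thetaForward K L i (p + 1) = Sum.inl true := by
  simp [thetaForward, not_lt.2 h]

theorem thetaBackward_succ_of_le {j : Fin t} {q : ℕ} (h : L j ≤ q + 1) :
    thetaBackward K L j (q + 1) = Sum.inl false := by
  simp [thetaBackward, not_lt.2 h]

theorem thetaDigraph_adj_u (hK : ∀ i, 1 ≤ K i) (y : ThetaVertex K L) :
    (thetaDigraph K L).Adj (Sum.inl false) y ↔ ∃ i, y = thetaForward K L i 1 := by
  constructor
  · rintro (⟨i, p, hp, h, rfl⟩ | ⟨j, q, hq, h, rfl⟩)
    · rcases p with _ | p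
      · exact ⟨i, rfl⟩
      · rw [thetaForward_succ_of_lt hp] at h
        simp at h
    · rcases q with _ | q
      · simp [thetaBackward_zero] at h
      · rw [thetaBackward_succ_of_lt hq] at h
        simp at h
  · rintro ⟨i, rfl⟩
    exact Or.inl ⟨i, 0, hK i, (thetaForward_zero i).symm, rfl⟩

theorem thetaDigraph_adj_v (hL : ∀ j, 1 ≤ L j) (y : ThetaVertex K L) :
    (thetaDigraph K L).Adj (Sum.inl true) y ↔ ∃ j, y = thetaBackward K L j 1 := by
  constructor
  · rintro (⟨i, p, hp, h, rfl⟩ | ⟨j, q, hq, h, rfl⟩)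
    · rcases p with _ | p
      · simp [thetaForward_zero] at h
      · rw [thetaForward_succ_of_lt hp] at h
        simp at h
    · rcases q with _ | q
      · exact ⟨j, rfl⟩
      · rw [thetaBackward_succ_of_lt hq] at h
        simp at h
  · rintro ⟨j, rfl⟩
    exact Or.inr ⟨j, 0, hL j, (thetaBackward_zero j).symm, rfl⟩

theorem thetaDigraph_adj_forward (i : Fin s) (p : Fin (K i - 1)) (y : ThetaVertex K L) :
    (thetaDigraph K L).Adj (Sum.inr (Sum.inl ⟨i, p⟩)) y ↔ y = thetaForward K L i (p + 2) := by
  have hp' : (p : ℕ) + 1 < K i := by have := p.2; omega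
  constructor
  · rintro (⟨i', p', hp, h, rfl⟩ | ⟨j, q, hq, h, rfl⟩)
    · rcases p' with _ | p'
      · simp [thetaForward_zero] at h
      · rw [thetaForward_succ_of_lt hp] at h
        simp only [Sum.inr.injEq, Sum.inl.injEq, Sigma.mk.injEq] at h
        obtain ⟨rfl, h⟩ := h
        obtain rfl := eq_of_heq h
        rfl
    · rcases q with _ | q
      · simp [thetaBackward_zero] at h
      · rw [thetaBackward_succ_of_lt hq] at h
        simp at h
  · rintro rfl
    exact Or.inl ⟨i, p + 1, hp', (thetaForward_succ_of_lt hp').symm, rfl⟩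

theorem thetaDigraph_adj_backward (j : Fin t) (q : Fin (L j - 1)) (y : ThetaVertex K L) :
    (thetaDigraph K L).Adj (Sum.inr (Sum.inr ⟨j, q⟩)) y ↔ y = thetaBackward K L j (q + 2) := by
  have hq' : (q : ℕ) + 1 < L j := by have := q.2; omega
  constructor
  · rintro (⟨i, p, hp, h, rfl⟩ | ⟨j', q', hq, h, rfl⟩)
    · rcases p with _ | p
      · simp [thetaForward_zero] at h
      · rw [thetaForward_succ_of_lt hp] at h
        simp at h
    · rcases q' with _ | q'
      · simp [thetaBackward_zero] at h
      · rw [thetaBackward_succ_of_lt hq] at h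
        simp only [Sum.inr.injEq, Sigma.mk.injEq] at h
        obtain ⟨rfl, h⟩ := h
        obtain rfl := eq_of_heq h
        rfl
  · rintro rfl
    exact Or.inr ⟨j, q + 1, hq', (thetaBackward_succ_of_lt hq').symm, rfl⟩

theorem zeta_le_of_mem_thetaSeq {m : ℕ} (hK : K ∈ thetaSeq s m) (i : Fin s) :
    zeta s i ≤ K i := by
  obtain ⟨hanti, h1, -, h2⟩ := hK
  unfold zeta
  split_ifs with h
  · exact h1 i
  · have hi := i.2
    refine (h2 ⟨s - 2, by omega⟩ (by simp; omega)).trans (hanti ?_)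
    rw [Fin.le_def]
    simp only
    omega

/-- Only the last entry can be `1`. Hence no two parallel paths are single arcs, and the outdegrees
of `u` and `v` are exactly `s` and `t`. -/
theorem two_le_or_two_le {m : ℕ} (hK : K ∈ thetaSeq s m) {i i' : Fin s} (h : i ≠ i') :
    2 ≤ K i ∨ 2 ≤ K i' := by
  have h1 := zeta_le_of_mem_thetaSeq hK i
  have h2 := zeta_le_of_mem_thetaSeq hK i'
  have h3 : (i : ℕ) ≠ i' := fun h' => h (Fin.ext h')
  unfold zeta at h1 h2
  split_ifs at h1 h2 <;> omega

theorem thetaForward_one_injective {m : ℕ} (hK : K ∈ thetaSeq s m) :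
    Function.Injective fun i => thetaForward K L i 1 := by
  intro i i' h
  by_contra hne
  have h1 := hK.2.1 i
  have h2 := hK.2.1 i'
  have h3 := two_le_or_two_le hK hne
  simp only [thetaForward, one_ne_zero, dite_false] at h
  split_ifs at h with ha hb hb
  · simp only [Sum.inr.injEq, Sum.inl.injEq, Sigma.mk.injEq] at h
    exact hne h.1
  · omega

theorem thetaBackward_one_injective {m : ℕ} (hL : L ∈ thetaSeq t m) :
    Function.Injective fun j => thetaBackward K L j 1 := by
  intro i i' h
  by_contra hne
  have h1 := hL.2.1 i
  have h2 := hL.2.1 i'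
  have h3 := two_le_or_two_le hL hne
  simp only [thetaBackward, one_ne_zero, dite_false] at h
  split_ifs at h with ha hb hb
  · simp only [Sum.inr.injEq, Sigma.mk.injEq] at h
    exact hne h.1
  · omega

/-- The weights `r ^ (distance to the end of the path) * (weight of the end)`. -/
def thetaWeight (K : Fin s → ℕ) (L : Fin t → ℕ) (r xu xv : ℝ) : ThetaVertex K L → ℝ
  | Sum.inl false => xu
  | Sum.inl true => xv
  | Sum.inr (Sum.inl ⟨i, p⟩) => r ^ (K i - 1 - p) * xv
  | Sum.inr (Sum.inr ⟨j, q⟩) => r ^ (L j - 1 - q) * xu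

theorem thetaWeight_forward {r xu xv : ℝ} {i : Fin s} {p : ℕ} (h : p + 1 ≤ K i) :
    thetaWeight K L r xu xv (thetaForward K L i (p + 1)) = r ^ (K i - 1 - p) * xv := by
  rcases h.lt_or_eq with h | h
  · rw [thetaForward_succ_of_lt h]
    rfl
  · rw [thetaForward_succ_of_le h.ge, ← h]
    simp [thetaWeight]

theorem thetaWeight_backward {r xu xv : ℝ} {j : Fin t} {q : ℕ} (h : q + 1 ≤ L j) :
    thetaWeight K L r xu xv (thetaBackward K L j (q + 1)) = r ^ (L j - 1 - q) * xu := by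
  rcases h.lt_or_eq with h | h
  · rw [thetaBackward_succ_of_lt h]
    rfl
  · rw [thetaBackward_succ_of_le h.ge, ← h]
    simp [thetaWeight]

theorem thetaWeight_pos {r xu xv : ℝ} (hr : 0 < r) (hu : 0 < xu) (hv : 0 < xv)
    (a : ThetaVertex K L) : 0 < thetaWeight K L r xu xv a := by
  rcases a with (_ | _) | ⟨i, p⟩ | ⟨j, q⟩ <;> simp only [thetaWeight] <;> positivity

end ThetaStructure

/-! ### The root equation and its monotonicity. -/

/-- The equation, in `r = (1 - α) / (ρ - α)`, for the `α`-spectral radius `ρ` of `Θ̃(K, L)`. -/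
structure IsThetaRoot (α : ℝ) {s t : ℕ} (K : Fin s → ℕ) (L : Fin t → ℕ) (r : ℝ) : Prop where
  pos : 0 < r
  le_one : r ≤ 1
  left_pos : 0 < (1 - α) - α * (s - 1) * r
  right_pos : 0 < (1 - α) - α * (t - 1) * r
  eq : ((1 - α) - α * (s - 1) * r) * ((1 - α) - α * (t - 1) * r) =
    (1 - α) ^ 2 * ((∑ i, r ^ K i) * ∑ j, r ^ L j)

theorem IsThetaRoot.alphaSpectralRadius_eq {α : ℝ} (h₀ : 0 ≤ α) (h₁ : α < 1) {s t m₁ m₂ : ℕ}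
    (hs : 1 ≤ s) {K : Fin s → ℕ} {L : Fin t → ℕ} (hK : K ∈ thetaSeq s m₁)
    (hL : L ∈ thetaSeq t m₂) {r : ℝ} (h : IsThetaRoot α K L r) :
    alphaSpectralRadius α (thetaDigraph K L) = ENNReal.ofReal (α + (1 - α) / r) := by
  have hα : 0 < 1 - α := by linarith
  have hr := h.pos
  have hPK : 0 < ∑ i, r ^ K i :=
    Finset.sum_pos (fun i _ => pow_pos hr _) ⟨⟨0, hs⟩, Finset.mem_univ _⟩
  -- This ratio of `xu` to `xv` solves the eigenvalue equation at `u` identically; the equation at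
  -- `v` is then `h.eq`.
  set xu := (1 - α) * ∑ i, r ^ K i with hxu
  set xv := (1 - α) - α * (s - 1) * r with hxv
  have hu : 0 < xu := mul_pos hα hPK
  have hv : 0 < xv := h.left_pos
  have hmulK : (∑ i, r ^ (K i - 1 - 0) * xv) * r = (∑ i, r ^ K i) * xv := by
    rw [Finset.sum_mul, Finset.sum_mul]
    refine Finset.sum_congr rfl fun i _ => ?_
    obtain ⟨k, hk⟩ := Nat.exists_eq_add_of_le (hK.2.1 i)
    rw [hk, show 1 + k - 1 - 0 = k by omega, pow_add]
    ring
  have hmulL : (∑ j, r ^ (L j - 1 - 0) * xu) * r = (∑ j, r ^ L j) * xu := by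
    rw [Finset.sum_mul, Finset.sum_mul]
    refine Finset.sum_congr rfl fun i _ => ?_
    obtain ⟨k, hk⟩ := Nat.exists_eq_add_of_le (hL.2.1 i)
    rw [hk, show 1 + k - 1 - 0 = k by omega, pow_add]
    ring
  refine matrixSpectralRadius_eq_of_pos_eigenvector (alphaMatrix_nonneg h₀ h₁ _)
    (thetaWeight_pos hr hu hv) ?_
  rintro ((_ | _) | ⟨i, p⟩ | ⟨j, q⟩)
  · rw [sum_alphaMatrix_mul α _ _ _ (thetaForward_one_injective hK)
      (thetaDigraph_adj_u hK.2.1), Fintype.card_fin,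
      Finset.sum_congr rfl fun i _ => thetaWeight_forward (p := 0) (hK.2.1 i)]
    simp only [thetaWeight]
    refine mul_right_cancel₀ hr.ne' ?_
    rw [add_mul, mul_assoc (1 - α), hmulK]
    field_simp
    rw [hxu, hxv]
    ring
  · rw [sum_alphaMatrix_mul α _ _ _ (thetaBackward_one_injective hL)
      (thetaDigraph_adj_v hL.2.1), Fintype.card_fin,
      Finset.sum_congr rfl fun i _ => thetaWeight_backward (q := 0) (hL.2.1 i)]
    simp only [thetaWeight]
    refine mul_right_cancel₀ hr.ne' ?_
    rw [add_mul, mul_assoc (1 - α), hmulL]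
    field_simp
    have := h.eq
    rw [← hxv] at this
    rw [hxu]
    linear_combination -this
  · have hp' : (p : ℕ) + 1 + 1 ≤ K i := by have := p.2; omega
    rw [sum_alphaMatrix_mul (ι := Unit) α _ _ (fun _ => thetaForward K L i (p + 1 + 1))
      (Function.injective_of_subsingleton _) (by simpa using thetaDigraph_adj_forward i p)]
    simp only [Finset.univ_unique, Finset.sum_singleton, Fintype.card_unit]
    rw [thetaWeight_forward hp']
    simp only [thetaWeight]
    rw [show K i - 1 - (p : ℕ) = K i - 1 - (p + 1) + 1 by omega, pow_succ]
    field_simp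
    push_cast
    ring
  · have hq' : (q : ℕ) + 1 + 1 ≤ L j := by have := q.2; omega
    rw [sum_alphaMatrix_mul (ι := Unit) α _ _ (fun _ => thetaBackward K L j (q + 1 + 1))
      (Function.injective_of_subsingleton _) (by simpa using thetaDigraph_adj_backward j q)]
    simp only [Finset.univ_unique, Finset.sum_singleton, Fintype.card_unit]
    rw [thetaWeight_backward hq']
    simp only [thetaWeight]
    rw [show L j - 1 - (q : ℕ) = L j - 1 - (q + 1) + 1 by omega, pow_succ]
    field_simp
    push_cast
    ring

theorem exists_isThetaRoot {α : ℝ} (h₀ : 0 ≤ α) (h₁ : α < 1) {s t : ℕ} (ht : 1 ≤ t)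
    (hst : t ≤ s) {K : Fin s → ℕ} {L : Fin t → ℕ} (hK : ∀ i, 1 ≤ K i) :
    ∃ r, IsThetaRoot α K L r := by
  have hα : 0 < 1 - α := by linarith
  have hs' : (0 : ℝ) ≤ s - 1 := by
    have : (1 : ℝ) ≤ s := by exact_mod_cast ht.trans hst
    linarith
  have ht' : (0 : ℝ) ≤ t - 1 := by
    have : (1 : ℝ) ≤ t := by exact_mod_cast ht
    linarith
  have hst' : (t : ℝ) - 1 ≤ s - 1 := by
    have : (t : ℝ) ≤ s := by exact_mod_cast hst
    linarith
  have hP : ∀ r : ℝ, 0 < r → 0 < (∑ i, r ^ K i) * ∑ j, r ^ L j := fun r hr =>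
    mul_pos (Finset.sum_pos (fun i _ => pow_pos hr _) ⟨⟨0, ht.trans hst⟩, Finset.mem_univ _⟩)
      (Finset.sum_pos (fun i _ => pow_pos hr _) ⟨⟨0, ht⟩, Finset.mem_univ _⟩)
  set g : ℝ → ℝ := fun r => (1 - α) ^ 2 * ((∑ i, r ^ K i) * ∑ j, r ^ L j) -
    ((1 - α) - α * (s - 1) * r) * ((1 - α) - α * (t - 1) * r) with hg
  have hcont : Continuous g := by fun_prop
  have hg0 : g 0 < 0 := by
    have : ∑ i, (0 : ℝ) ^ K i = 0 :=
      Finset.sum_eq_zero fun i _ => zero_pow (by have := hK i; omega)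
    simp only [hg, this]
    nlinarith
  -- `R` is `1`, or the zero of the left factor if that lies below `1`. The left factor is the
  -- smaller one because `t ≤ s`, so both are nonnegative on `[0, R]`.
  obtain ⟨R, hR0, hR1, hRl, hgR⟩ : ∃ R : ℝ, 0 < R ∧ R ≤ 1 ∧
      0 ≤ (1 - α) - α * (s - 1) * R ∧ 0 ≤ g R := by
    by_cases hc : α * (s - 1) ≤ 1 - α
    · refine ⟨1, one_pos, le_rfl, by linarith, ?_⟩
      have hs1 : (1 : ℝ) ≤ s := by linarith
      have ht1 : (1 : ℝ) ≤ t := by linarith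
      simp only [hg, one_pow, Finset.sum_const, Finset.card_univ, Fintype.card_fin, nsmul_eq_mul,
        mul_one]
      have e1 : (1 - α - α * (s - 1)) * (1 - α - α * (t - 1)) ≤ (1 - α) * (1 - α) := by
        refine mul_le_mul (by nlinarith) (by nlinarith) (by nlinarith) hα.le
      have e2 : (1 : ℝ) ≤ s * t := by nlinarith
      nlinarith [mul_le_mul_of_nonneg_left e2 (sq_nonneg (1 - α))]
    · have hpos : 0 < α * (s - 1) := by linarith
      refine ⟨(1 - α) / (α * (s - 1)), by positivity, ?_, ?_, ?_⟩
      · rw [div_le_one hpos]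
        linarith
      · rw [mul_div_cancel₀ _ hpos.ne']
        simp
      · simp only [hg]
        rw [mul_div_cancel₀ _ hpos.ne', sub_self, zero_mul, sub_zero]
        have := hP ((1 - α) / (α * (s - 1))) (by positivity)
        positivity
  obtain ⟨r, ⟨hr0, hrR⟩, hr⟩ := intermediate_value_Icc hR0.le hcont.continuousOn ⟨hg0.le, hgR⟩
  have hrpos : 0 < r := by
    rcases hr0.lt_or_eq with h | h
    · exact h
    · rw [← h] at hr
      linarith
  have hαs : α * (s - 1) * r ≤ α * (s - 1) * R :=
    mul_le_mul_of_nonneg_left hrR (mul_nonneg h₀ hs')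
  have heq : ((1 - α) - α * (s - 1) * r) * ((1 - α) - α * (t - 1) * r) =
    (1 - α) ^ 2 * ((∑ i, r ^ K i) * ∑ j, r ^ L j) := by
    simp only [hg] at hr
    linarith
  have hl : 0 < (1 - α) - α * (s - 1) * r := by
    -- A vanishing factor would contradict the positivity of the path polynomials.
    refine lt_of_le_of_ne (by linarith) fun h => ?_
    rw [← h, zero_mul] at heq
    have := mul_pos (pow_pos hα 2) (hP r hrpos)
    linarith
  have hαt : α * (t - 1) * r ≤ α * (s - 1) * r :=
    mul_le_mul_of_nonneg_right (mul_le_mul_of_nonneg_left hst' h₀) hrpos.le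
  exact ⟨r, hrpos, hrR.trans hR1, hl, by linarith, heq⟩

/-- A pair of sequences with larger path polynomials has the smaller root. -/
theorem IsThetaRoot.le_of_le {α : ℝ} (h₀ : 0 ≤ α) (h₁ : α < 1) {s t : ℕ} (ht : 1 ≤ t)
    (hst : t ≤ s) {K K' : Fin s → ℕ} {L L' : Fin t → ℕ} (hK : ∀ i, 1 ≤ K i) {r r' : ℝ}
    (h : IsThetaRoot α K L r) (h' : IsThetaRoot α K' L' r')
    (hle : (∑ i, r' ^ K' i) * ∑ j, r' ^ L' j ≤ (∑ i, r' ^ K i) * ∑ j, r' ^ L j) :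
    r ≤ r' := by
  -- Passing from `r'` up to `r` would strictly increase the path product without increasing the
  -- left side of the equation.
  by_contra! hlt
  have hα : 0 < 1 - α := by linarith
  have hs' : (0 : ℝ) ≤ s - 1 := by
    have : (1 : ℝ) ≤ s := by exact_mod_cast ht.trans hst
    linarith
  have ht' : (0 : ℝ) ≤ t - 1 := by
    have : (1 : ℝ) ≤ t := by exact_mod_cast ht
    linarith
  have hr' := h'.pos
  have e1 : (∑ i, r' ^ K i) < ∑ i, r ^ K i :=
    Finset.sum_lt_sum_of_nonempty ⟨⟨0, ht.trans hst⟩, Finset.mem_univ _⟩ fun i _ =>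
      pow_lt_pow_left₀ hlt hr'.le (by have := hK i; omega)
  have e2 : (∑ j, r' ^ L j) ≤ ∑ j, r ^ L j :=
    Finset.sum_le_sum fun i _ => pow_le_pow_left₀ hr'.le hlt.le _
  have e3 : 0 < ∑ j, r' ^ L j :=
    Finset.sum_pos (fun i _ => pow_pos hr' _) ⟨⟨0, ht⟩, Finset.mem_univ _⟩
  have e4 : (∑ i, r' ^ K i) * ∑ j, r' ^ L j < (∑ i, r ^ K i) * ∑ j, r ^ L j :=
    mul_lt_mul e1 e2 e3 (Finset.sum_nonneg fun i _ => pow_nonneg h.pos.le _)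
  have e5 := mul_lt_mul_of_pos_left (hle.trans_lt e4) (pow_pos hα 2)
  rw [← h.eq, ← h'.eq] at e5
  have e6 : (1 - α - α * (s - 1) * r) * (1 - α - α * (t - 1) * r) ≤
      (1 - α - α * (s - 1) * r') * (1 - α - α * (t - 1) * r') := by
    refine mul_le_mul ?_ ?_ h.right_pos.le h'.left_pos.le
    · have := mul_le_mul_of_nonneg_left hlt.le (mul_nonneg h₀ hs')
      linarith
    · have := mul_le_mul_of_nonneg_left hlt.le (mul_nonneg h₀ ht')
      linarith
  linarith

/-- At `r = 1` the left side is at most `(1 - α)²`, but the right side is `s t (1 - α)²` with `s t ≥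
2`. Strictness is what makes powers of `r` distinguish exponents in the equality cases. -/
theorem IsThetaRoot.lt_one {α : ℝ} (h₀ : 0 ≤ α) {s t : ℕ} (ht : 1 ≤ t)
    (hs : 2 ≤ s) (h₁ : α < 1) {K : Fin s → ℕ} {L : Fin t → ℕ} {r : ℝ}
    (h : IsThetaRoot α K L r) : r < 1 := by
  refine lt_of_le_of_ne h.le_one fun hr => ?_
  have hα : 0 < 1 - α := by linarith
  have hs' : (2 : ℝ) ≤ s := by exact_mod_cast hs
  have ht' : (1 : ℝ) ≤ t := by exact_mod_cast ht
  have e := h.eq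
  have e1 := h.left_pos
  have e2 := h.right_pos
  subst hr
  simp only [one_pow, Finset.sum_const, Finset.card_univ, Fintype.card_fin, nsmul_eq_mul,
    mul_one] at e e1 e2
  have e3 : (1 - α - α * (s - 1)) * (1 - α - α * (t - 1)) ≤ (1 - α) * (1 - α) :=
    mul_le_mul (by nlinarith) (by nlinarith) e2.le hα.le
  have e4 : (2 : ℝ) ≤ s * t := by nlinarith
  nlinarith [mul_le_mul_of_nonneg_left e4 (sq_nonneg (1 - α)), pow_pos hα 2]

/-- Comparison of `α`-spectral radii through the path polynomials. -/
theorem alphaSpectralRadius_thetaDigraph_compare {α : ℝ} (h₀ : 0 ≤ α) (h₁ : α < 1)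
    {s t m₁ m₂ n₁ n₂ : ℕ} (ht : 1 ≤ t) (hst : t ≤ s) (hs : 2 ≤ s)
    {K K' : Fin s → ℕ} {L L' : Fin t → ℕ} (hK : K ∈ thetaSeq s m₁) (hL : L ∈ thetaSeq t m₂)
    (hK' : K' ∈ thetaSeq s n₁) (hL' : L' ∈ thetaSeq t n₂)
    (hle : ∀ r : ℝ, 0 < r → r < 1 →
      (∑ i, r ^ K i) * ∑ j, r ^ L j ≤ (∑ i, r ^ K' i) * ∑ j, r ^ L' j) :
    alphaSpectralRadius α (thetaDigraph K L) ≤ alphaSpectralRadius α (thetaDigraph K' L') ∧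
      (alphaSpectralRadius α (thetaDigraph K L) = alphaSpectralRadius α (thetaDigraph K' L') →
        ∃ r : ℝ, 0 < r ∧ r < 1 ∧
          (∑ i, r ^ K i) * ∑ j, r ^ L j = (∑ i, r ^ K' i) * ∑ j, r ^ L' j) := by
  have hα : 0 < 1 - α := by linarith
  obtain ⟨r, hr⟩ := exists_isThetaRoot (L := L) h₀ h₁ ht hst hK.2.1
  obtain ⟨r', hr'⟩ := exists_isThetaRoot (L := L') h₀ h₁ ht hst hK'.2.1
  have hrr : r' ≤ r :=
    hr'.le_of_le h₀ h₁ ht hst hK'.2.1 hr (hle r hr.pos (hr.lt_one h₀ ht hs h₁))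
  rw [hr.alphaSpectralRadius_eq h₀ h₁ (by omega) hK hL,
    hr'.alphaSpectralRadius_eq h₀ h₁ (by omega) hK' hL']
  refine ⟨ENNReal.ofReal_le_ofReal ?_, fun heq => ?_⟩
  · have := div_le_div_of_nonneg_left hα.le hr'.pos hrr
    linarith
  · have e1 := div_pos hα hr.pos
    have e2 := div_pos hα hr'.pos
    rw [ENNReal.ofReal_eq_ofReal_iff (by linarith) (by linarith)] at heq
    have e3 : (1 - α) / r = (1 - α) / r' := by linarith
    obtain rfl : r = r' := by
      have := hr.pos.ne'
      have := hr'.pos.ne'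
      field_simp at e3
      exact e3.symm
    refine ⟨r, hr.pos, hr.lt_one h₀ ht hs h₁, ?_⟩
    exact mul_left_cancel₀ (pow_pos hα 2).ne' (hr.eq.symm.trans hr'.eq)

/-! ### Isomorphisms: exchange of `u` and `v`, and the cyclic case. -/

theorem DigraphIso.thetaDigraph_swap {s : ℕ} (K L : Fin s → ℕ) :
    DigraphIso (thetaDigraph K L) (thetaDigraph L K) := by
  let e : ThetaVertex K L ≃ ThetaVertex L K := Equiv.sumCongr Equiv.boolNot (Equiv.sumComm _ _)
  have hf : ∀ i p, e (thetaForward K L i p) = thetaBackward L K i p := by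
    intro i p
    unfold thetaForward thetaBackward
    split_ifs <;> rfl
  have hb : ∀ i p, e (thetaBackward K L i p) = thetaForward L K i p := by
    intro i p
    unfold thetaForward thetaBackward
    split_ifs <;> rfl
  refine ⟨⟨e, fun {a b} => ?_⟩⟩
  simp only [thetaDigraph, ← hf, ← hb, e.apply_eq_iff_eq]
  exact or_comm

/-- The vertices of `Θ̃((k), (l))` in their cyclic order, starting from `u`. -/
def thetaCycleVertex (K L : Fin 1 → ℕ) (p : ℕ) : ThetaVertex K L :=
  if p < K 0 then thetaForward K L 0 p else thetaBackward K L 0 (p - K 0)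

theorem thetaCycleVertex_bijective {K L : Fin 1 → ℕ} (hK : 1 ≤ K 0) (hL : 1 ≤ L 0) {m : ℕ}
    (hm : K 0 + L 0 = m) :
    Function.Bijective fun p : Fin m => thetaCycleVertex K L p := by
  have hsurj : Function.Surjective fun p : Fin m => thetaCycleVertex K L p := by
    rintro ((_ | _) | ⟨i, p⟩ | ⟨j, q⟩)
    · exact ⟨⟨0, by omega⟩, by
        simp [thetaCycleVertex, Nat.pos_iff_ne_zero.1 hK, thetaForward_zero]⟩
    · exact ⟨⟨K 0, by omega⟩, by simp [thetaCycleVertex, thetaBackward_zero]⟩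
    · obtain rfl := Subsingleton.elim i 0
      have hp : (p : ℕ) + 1 < K 0 := by have := p.2; omega
      exact ⟨⟨p + 1, by omega⟩, by simp [thetaCycleVertex, hp, thetaForward_succ_of_lt hp]⟩
    · obtain rfl := Subsingleton.elim j 0
      have hq : (q : ℕ) + 1 < L 0 := by have := q.2; omega
      refine ⟨⟨K 0 + (q + 1), by omega⟩, ?_⟩
      simp [thetaCycleVertex, thetaBackward_succ_of_lt hq]
  refine (Fintype.bijective_iff_surjective_and_card _).2 ⟨hsurj, ?_⟩
  simp
  omega

/-- The right-hand side depends only on `m`, so the position of `v` on the cycle is immaterial. -/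
theorem thetaCycleVertex_adj_iff {K L : Fin 1 → ℕ} (hK : 1 ≤ K 0) (hL : 1 ≤ L 0) {m : ℕ}
    (hm : K 0 + L 0 = m) (p q : Fin m) :
    (thetaDigraph K L).Adj (thetaCycleVertex K L p) (thetaCycleVertex K L q) ↔
      (q : ℕ) = (p + 1) % m := by
  have hm0 : 0 < m := by omega
  have hinj := (thetaCycleVertex_bijective hK hL hm).injective
  have hfwd : ∀ p < K 0, thetaCycleVertex K L p = thetaForward K L 0 p := fun p hp => by
    simp [thetaCycleVertex, hp]
  have hbwd : ∀ q, thetaCycleVertex K L (K 0 + q) = thetaBackward K L 0 q := fun q => by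
    simp [thetaCycleVertex]
  have hend : thetaForward K L 0 (K 0) = thetaCycleVertex K L (K 0) := by
    rw [← Nat.add_zero (K 0), hbwd, thetaBackward_zero]
    obtain ⟨k, hk⟩ := Nat.exists_eq_add_of_le' hK
    rw [Nat.add_zero, hk]
    exact thetaForward_succ_of_le hk.le
  have hend' : thetaBackward K L 0 (L 0) = thetaCycleVertex K L 0 := by
    rw [hfwd 0 hK, thetaForward_zero]
    obtain ⟨k, hk⟩ := Nat.exists_eq_add_of_le' hL
    rw [hk]
    exact thetaBackward_succ_of_le hk.le
  have hnext : ∀ p < m,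
      (∃ i : Fin 1, ∃ p' < K i, thetaCycleVertex K L p = thetaForward K L i p' ∧
        thetaCycleVertex K L ((p + 1) % m) = thetaForward K L i (p' + 1)) ∨
      (∃ j : Fin 1, ∃ q' < L j, thetaCycleVertex K L p = thetaBackward K L j q' ∧
        thetaCycleVertex K L ((p + 1) % m) = thetaBackward K L j (q' + 1)) := by
    intro p hp
    by_cases h : p < K 0
    · refine Or.inl ⟨0, p, h, hfwd p h, ?_⟩
      rw [Nat.mod_eq_of_lt (by omega)]
      rcases (Nat.succ_le_of_lt h).lt_or_eq with h' | h'
      · exact hfwd _ h'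
      · rw [show p + 1 = K 0 from h', hend]
    · refine Or.inr ⟨0, p - K 0, by omega, ?_, ?_⟩
      · rw [← hbwd]
        congr 1
        omega
      · rcases (Nat.succ_le_of_lt hp).lt_or_eq with h' | h'
        · rw [Nat.mod_eq_of_lt h', ← hbwd]
          congr 1
          omega
        · rw [show p + 1 = m from h', Nat.mod_self, ← hend']
          congr 1
          omega
  constructor
  · have hcases : ∀ (x y : ThetaVertex K L), (thetaDigraph K L).Adj x y →
        ∃ p < m, x = thetaCycleVertex K L p ∧ y = thetaCycleVertex K L ((p + 1) % m) := by
      rintro x y (⟨i, p, hp, rfl, rfl⟩ | ⟨j, q, hq, rfl, rfl⟩)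
      · obtain rfl := Subsingleton.elim i 0
        refine ⟨p, by omega, (hfwd p hp).symm, ?_⟩
        rw [Nat.mod_eq_of_lt (by omega)]
        rcases (Nat.succ_le_of_lt hp).lt_or_eq with h' | h'
        · exact (hfwd _ h').symm
        · rw [show p + 1 = K 0 from h', hend]
      · obtain rfl := Subsingleton.elim j 0
        refine ⟨K 0 + q, by omega, (hbwd q).symm, ?_⟩
        rcases (Nat.succ_le_of_lt hq).lt_or_eq with h' | h'
        · rw [Nat.mod_eq_of_lt (by omega), add_assoc, hbwd]
        · rw [show K 0 + q + 1 = m by omega, Nat.mod_self, show q + 1 = L 0 from h', hend']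
    intro h
    obtain ⟨p', hp', h1, h2⟩ := hcases _ _ h
    have e1 := hinj (a₁ := p) (a₂ := ⟨p', hp'⟩) h1
    have e2 := hinj (a₁ := q) (a₂ := ⟨(p' + 1) % m, Nat.mod_lt _ hm0⟩) h2
    rw [e1, e2]
  · intro h
    rw [h]
    exact hnext p p.2

theorem DigraphIso.thetaDigraph_cycle {K L K' L' : Fin 1 → ℕ} (hK : 1 ≤ K 0) (hL : 1 ≤ L 0)
    (hK' : 1 ≤ K' 0) (hL' : 1 ≤ L' 0) (h : K 0 + L 0 = K' 0 + L' 0) :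
    DigraphIso (thetaDigraph K L) (thetaDigraph K' L') := by
  let e := Equiv.ofBijective _ (thetaCycleVertex_bijective hK hL rfl)
  let e' := Equiv.ofBijective _ (thetaCycleVertex_bijective hK' hL' h.symm)
  refine ⟨⟨e.symm.trans e', fun {a b} => ?_⟩⟩
  obtain ⟨p, rfl⟩ := e.surjective a
  obtain ⟨q, rfl⟩ := e.surjective b
  simp only [Equiv.trans_apply, Equiv.symm_apply_apply]
  exact (thetaCycleVertex_adj_iff hK' hL' h.symm p q).trans
    (thetaCycleVertex_adj_iff hK hL rfl p q).symm

/-! ### Path polynomials of sequences of fixed length and sum. -/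

theorem sum_zeta (s : ℕ) : ∑ i, zeta (s + 1) i = 2 * s + 1 := by
  rw [Fin.sum_univ_castSucc]
  simp [zeta, (Fin.is_lt _).ne, mul_comm]

theorem sum_pow_zeta (s : ℕ) (r : ℝ) : ∑ i, r ^ zeta (s + 1) i = s * r ^ 2 + r := by
  rw [Fin.sum_univ_castSucc]
  simp [zeta, (Fin.is_lt _).ne]

theorem zetaTop_eq_zeta_add (s a : ℕ) (i : Fin (s + 1)) :
    zetaTop (s + 1) (2 * s + 1 + a) i = zeta (s + 1) i + if i = 0 then a else 0 := by
  have hi := i.2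
  unfold zetaTop zeta
  simp only [Fin.ext_iff, Fin.val_zero]
  split_ifs <;> omega

theorem zetaTop_zero_excess (s : ℕ) : zetaTop (s + 1) (2 * s + 1) = zeta (s + 1) := by
  ext i
  simpa using zetaTop_eq_zeta_add s 0 i

theorem zetaTop_mem_thetaSeq (s a : ℕ) :
    zetaTop (s + 1) (2 * s + 1 + a) ∈ thetaSeq (s + 1) (2 * s + 1 + a) := by
  refine ⟨fun i j hij => ?_, fun i => ?_, ?_, fun i hi => ?_⟩
  · have hi := i.2
    have hj := j.2
    rw [Fin.le_def] at hij
    rw [zetaTop_eq_zeta_add, zetaTop_eq_zeta_add]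
    simp only [zeta, Fin.ext_iff, Fin.val_zero]
    split_ifs <;> omega
  · rw [zetaTop_eq_zeta_add]
    unfold zeta
    split_ifs <;> omega
  · simp_rw [zetaTop_eq_zeta_add]
    rw [Finset.sum_add_distrib, sum_zeta]
    simp
  · rw [zetaTop_eq_zeta_add]
    unfold zeta
    split_ifs <;> omega

theorem zeta_mem_thetaSeq (s : ℕ) : zeta (s + 1) ∈ thetaSeq (s + 1) (2 * s + 1) := by
  simpa [zetaTop_zero_excess] using zetaTop_mem_thetaSeq s 0

theorem sum_pow_zetaTop (s a : ℕ) (r : ℝ) :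
    ∑ i, r ^ zetaTop (s + 2) (2 * (s + 1) + 1 + a) i =
      (s + 1) * r ^ 2 + r - r ^ 2 * (1 - r ^ a) := by
  have h : ∀ i : Fin (s + 2), r ^ zetaTop (s + 2) (2 * (s + 1) + 1 + a) i =
      r ^ zeta (s + 2) i - if i = 0 then r ^ 2 * (1 - r ^ a) else 0 := by
    intro i
    rw [zetaTop_eq_zeta_add]
    split_ifs with hi
    · subst hi
      simp [zeta]
      ring
    · simp
  simp_rw [h]
  rw [Finset.sum_sub_distrib, sum_pow_zeta]
  simp

/-- Induction on `(1 - x) + (1 - y) = (1 - x y) + (1 - x) (1 - y)`. -/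
theorem one_sub_pow_sum_le {r : ℝ} (h₀ : 0 < r) (h₁ : r < 1) {n : ℕ} (a : Fin n → ℕ) :
    1 - r ^ ∑ i, a i ≤ ∑ i, (1 - r ^ a i) := by
  induction n with
  | zero => simp
  | succ n ih =>
    rw [Fin.sum_univ_succ, Fin.sum_univ_succ, pow_add]
    have h1 := ih fun i => a i.succ
    have h2 := pow_le_one₀ h₀.le h₁.le (n := a 0)
    have h3 := pow_le_one₀ h₀.le h₁.le (n := ∑ i : Fin n, a i.succ)
    nlinarith

theorem exists_excess {s m : ℕ} {K : Fin (s + 1) → ℕ} (hK : K ∈ thetaSeq (s + 1) m) :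
    ∃ a : Fin (s + 1) → ℕ, (∀ i, K i = zeta (s + 1) i + a i) ∧ 2 * s + 1 + ∑ i, a i = m := by
  refine ⟨fun i => K i - zeta (s + 1) i, fun i => ?_, ?_⟩
  · exact (Nat.add_sub_cancel' (zeta_le_of_mem_thetaSeq hK i)).symm
  · rw [← sum_zeta, ← Finset.sum_add_distrib, ← hK.2.2.1]
    exact Finset.sum_congr rfl fun i _ => Nat.add_sub_cancel' (zeta_le_of_mem_thetaSeq hK i)

/-- Among the sequences of given length and sum, `zetaTop` maximizes the path polynomial. -/
theorem sum_pow_le_sum_pow_zetaTop {r : ℝ} (h₀ : 0 < r) (h₁ : r < 1) {s m : ℕ}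
    {K : Fin (s + 2) → ℕ} (hK : K ∈ thetaSeq (s + 2) m) :
    ∑ i, r ^ K i ≤ ∑ i, r ^ zetaTop (s + 2) m i ∧
      (∑ i, r ^ K i = ∑ i, r ^ zetaTop (s + 2) m i → K = zetaTop (s + 2) m) := by
  obtain ⟨a, ha, hm⟩ := exists_excess hK
  have hw : ∀ n : ℕ, 0 ≤ 1 - r ^ n := fun n => by
    have := pow_le_one₀ h₀.le h₁.le (n := n)
    linarith
  -- Excess `a i` costs `r ^ zeta i * (1 - r ^ a i)`, and the entries of `zeta` are at most `2`.
  have hterm : ∀ i, r ^ 2 * (1 - r ^ a i) ≤ r ^ zeta (s + 2) i - r ^ K i := by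
    intro i
    rw [ha, pow_add, ← mul_one_sub]
    refine mul_le_mul_of_nonneg_right (pow_le_pow_of_le_one h₀.le h₁.le ?_) (hw _)
    unfold zeta
    split_ifs <;> omega
  have hsum := Finset.sum_le_sum fun i (_ : i ∈ Finset.univ) => hterm i
  rw [Finset.sum_sub_distrib, ← Finset.mul_sum] at hsum
  have hsub := one_sub_pow_sum_le h₀ h₁ fun i : Fin (s + 1) => a i.succ
  have hr2 : 0 < r ^ 2 := by positivity
  rw [← hm, sum_pow_zetaTop]
  have hz := sum_pow_zeta (s + 1) r
  push_cast at hz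
  rw [hz] at hsum
  rw [Fin.sum_univ_succ (fun i => 1 - r ^ a i)] at hsum
  rw [Fin.sum_univ_succ a, pow_add]
  set A := ∑ i : Fin (s + 1), a i.succ with hA
  -- This product is the slack from merging the excess `A` of the later entries into the first;
  -- equality forces it to vanish.
  have hprod : 0 ≤ (1 - r ^ a 0) * (1 - r ^ A) := mul_nonneg (hw _) (hw _)
  have hchain : r ^ 2 * ((1 - r ^ a 0 * r ^ A) + (1 - r ^ a 0) * (1 - r ^ A)) ≤
      (s + 1) * r ^ 2 + r - ∑ i, r ^ K i :=
    le_trans (mul_le_mul_of_nonneg_left (by linarith) hr2.le) hsum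
  have hmul : 0 ≤ r ^ 2 * ((1 - r ^ a 0) * (1 - r ^ A)) := by positivity
  refine ⟨by linarith, fun heq => ?_⟩
  have hzero : r ^ 2 * ((1 - r ^ a 0) * (1 - r ^ A)) = 0 := le_antisymm (by linarith) hmul
  have hone : ∀ n : ℕ, 1 - r ^ n = 0 → n = 0 := by
    intro n hn
    by_contra hne
    have := pow_lt_one₀ h₀.le h₁ hne
    linarith
  have hrest : ∀ i : Fin (s + 1), a i.succ = 0 := by
    rcases mul_eq_zero.1 (mul_eq_zero.1 hzero |>.resolve_left hr2.ne') with h | h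
    -- If the first entry has no excess, monotonicity bounds all entries by `2`, so only the last
    -- can exceed `zeta`. Its excess costs a factor `r` instead of `r ^ 2`, which is strictly worse
    -- unless it is zero.
    · have h0 := hone _ h
      have hle : ∀ i, K i ≤ 2 := by
        intro i
        have h1 := hK.1 (Fin.zero_le i)
        rw [ha 0, h0] at h1
        simpa [zeta] using h1
      have hlast : a (Fin.last (s + 1)) = 0 := by
        refine hone _ ?_
        have hall : ∀ i, a i ≠ 0 → i = Fin.last (s + 1) := by
          intro i hi
          by_contra hne
          have h1 := hle i
          have h2 : (i : ℕ) + 1 ≠ s + 2 := fun h' => hne (Fin.ext (by simp; omega))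
          rw [ha i] at h1
          simp only [zeta, h2, if_false] at h1
          omega
        have hs1 : ∑ i, r ^ K i = (s + 1) * r ^ 2 + r -
            r * (1 - r ^ a (Fin.last (s + 1))) := by
          have h3 : ∀ i, r ^ K i = r ^ zeta (s + 2) i -
              if i = Fin.last (s + 1) then r * (1 - r ^ a (Fin.last (s + 1))) else 0 := by
            intro i
            rw [ha i]
            split_ifs with hi
            · subst hi
              simp [zeta]
              ring
            · have : a i = 0 := by
                by_contra h'
                exact hi (hall i h')
              simp [this]
          simp_rw [h3]
          rw [Finset.sum_sub_distrib, hz]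
          simp
        have hA' : A = a (Fin.last (s + 1)) := by
          rw [hA, ← Fin.succ_last]
          refine Finset.sum_eq_single (Fin.last s) (fun i _ hi => ?_) (by simp)
          by_contra h'
          have := hall _ h'
          rw [← Fin.succ_last] at this
          exact hi (Fin.succ_injective _ this)
        rw [hs1, h0, hA'] at heq
        have h4 : (r - r ^ 2) * (1 - r ^ a (Fin.last (s + 1))) = 0 := by
          linear_combination -heq
        refine (mul_eq_zero.1 h4).resolve_left ?_
        nlinarith
      intro i
      by_contra hne
      have h1 := hle i.succ
      by_cases hi : i.succ = Fin.last (s + 1)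
      · exact hne (hi ▸ hlast)
      · have h2 : (i.succ : ℕ) + 1 ≠ s + 2 := fun h' => hi (Fin.ext (by simp at h' ⊢; omega))
        rw [ha i.succ] at h1
        simp only [zeta, h2, if_false] at h1
        omega
    · intro i
      exact Finset.sum_eq_zero_iff.1 (hone _ h) i (Finset.mem_univ _)
  ext i
  rw [zetaTop_eq_zeta_add (s + 1), ha i]
  congr 1
  rw [hA]
  refine Fin.cases ?_ (fun j => ?_) i
  · simp [hrest]
  · simp [hrest]

/-! ### Extremal products of two path polynomials. -/

theorem sum_pow_mul_sum_pow_le_of_two_le {r : ℝ} (h₀ : 0 < r) (h₁ : r < 1) {s t m₁ m₂ m : ℕ}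
    (hst : t ≤ s) (hm : m₁ + m₂ = m) {K : Fin (s + 2) → ℕ} (hK : K ∈ thetaSeq (s + 2) m₁)
    {L : Fin (t + 2) → ℕ} (hL : L ∈ thetaSeq (t + 2) m₂) :
    (∑ i, r ^ K i) * ∑ j, r ^ L j ≤ (∑ i, r ^ zetaTop (s + 2) (m + 1 - 2 * (t + 2)) i) *
        ∑ j, r ^ zeta (t + 2) j ∧
      ((∑ i, r ^ K i) * ∑ j, r ^ L j = (∑ i, r ^ zetaTop (s + 2) (m + 1 - 2 * (t + 2)) i) *
          ∑ j, r ^ zeta (t + 2) j →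
        (K = zetaTop (s + 2) (m + 1 - 2 * (t + 2)) ∧ L = zeta (t + 2)) ∨
        (s = t ∧ K = zeta (s + 2) ∧ L = zetaTop (t + 2) (m + 1 - 2 * (s + 2)))) := by
  obtain ⟨a, ha⟩ : ∃ a, m₁ = 2 * (s + 1) + 1 + a := by
    obtain ⟨a, -, ha⟩ := exists_excess hK
    exact ⟨_, ha.symm⟩
  obtain ⟨b, hb⟩ : ∃ b, m₂ = 2 * (t + 1) + 1 + b := by
    obtain ⟨b, -, hb⟩ := exists_excess hL
    exact ⟨_, hb.symm⟩
  have hmt : m + 1 - 2 * (t + 2) = 2 * (s + 1) + 1 + (a + b) := by omega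
  have hms : m + 1 - 2 * (s + 2) = 2 * (t + 1) + 1 + (a + b) := by omega
  rw [hmt, hms]
  subst ha hb
  obtain ⟨hKle, hKeq⟩ := sum_pow_le_sum_pow_zetaTop h₀ h₁ hK
  obtain ⟨hLle, hLeq⟩ := sum_pow_le_sum_pow_zetaTop h₀ h₁ hL
  have hKpos : 0 < ∑ i, r ^ K i :=
    Finset.sum_pos (fun i _ => pow_pos h₀ _) Finset.univ_nonempty
  have hLpos : 0 < ∑ i, r ^ L i :=
    Finset.sum_pos (fun i _ => pow_pos h₀ _) Finset.univ_nonempty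
  have hz := sum_pow_zeta (t + 1) r
  push_cast at hz
  rw [hz]
  rw [sum_pow_zetaTop] at hKle hKeq hLle hLeq ⊢
  rw [pow_add r a b]
  have hst' : (t : ℝ) ≤ s := by exact_mod_cast hst
  have hone : ∀ n : ℕ, r ^ n = 1 → n = 0 := by
    intro n hn
    by_contra hne
    exact (pow_lt_one₀ h₀.le h₁ hne).ne hn
  have hwa : r ^ a ≤ 1 := pow_le_one₀ h₀.le h₁.le
  have hwb : r ^ b ≤ 1 := pow_le_one₀ h₀.le h₁.le
  have hr2 : 0 < r ^ 2 := by positivity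
  set x := r ^ a
  set y := r ^ b
  set PK := ∑ i, r ^ K i
  set PL := ∑ i, r ^ L i
  set A : ℝ := (s + 1) * r ^ 2 + r
  set B : ℝ := (t + 1) * r ^ 2 + r
  have hAB : 0 ≤ A - B := by
    have : A - B = (s - t) * r ^ 2 := by ring
    rw [this]
    exact mul_nonneg (by linarith) hr2.le
  have hB : 0 < B - r ^ 2 := by
    have : B - r ^ 2 = t * r ^ 2 + r := by ring
    rw [this]
    positivity
  -- The gain from moving the excess `b` of `L` to `K`. It vanishes only if `y = 1`, or if `A = B`
  -- and `x = 1`; the latter means `s = t` with all excess on `L`, the mirror image of the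
  -- maximizer.
  have hgap : (A - r ^ 2 * (1 - x * y)) * B - (A - r ^ 2 * (1 - x)) * (B - r ^ 2 * (1 - y)) =
      r ^ 2 * ((1 - y) * (A - B)) + r ^ 2 * ((1 - x) * (1 - y) * (B - r ^ 2)) := by ring
  have hg1 : 0 ≤ r ^ 2 * ((1 - y) * (A - B)) :=
    mul_nonneg hr2.le (mul_nonneg (by linarith) hAB)
  have hg2 : 0 ≤ r ^ 2 * ((1 - x) * (1 - y) * (B - r ^ 2)) :=
    mul_nonneg hr2.le (mul_nonneg (mul_nonneg (by linarith) (by linarith)) hB.le)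
  have hc1 : PK * PL ≤ PK * (B - r ^ 2 * (1 - y)) := mul_le_mul_of_nonneg_left hLle hKpos.le
  have hc2 : PK * (B - r ^ 2 * (1 - y)) ≤ (A - r ^ 2 * (1 - x)) * (B - r ^ 2 * (1 - y)) :=
    mul_le_mul_of_nonneg_right hKle (hLpos.le.trans hLle)
  refine ⟨by linarith, fun heq => ?_⟩
  have hL' := hLeq (mul_left_cancel₀ hKpos.ne' (by linarith))
  have hK' := hKeq (mul_right_cancel₀ (hLpos.trans_le hLle).ne' (le_antisymm hc2 (by linarith)))
  have hy1 : r ^ 2 * ((1 - y) * (A - B)) = 0 := by linarith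
  have hy2 : r ^ 2 * ((1 - x) * (1 - y) * (B - r ^ 2)) = 0 := by linarith
  rw [mul_eq_zero, or_iff_right hr2.ne', mul_eq_zero] at hy1
  rw [mul_eq_zero, or_iff_right hr2.ne', mul_eq_zero, or_iff_left hB.ne', mul_eq_zero] at hy2
  by_cases hy : 1 - y = 0
  · obtain rfl : b = 0 := hone b (by linarith)
    left
    rw [hK', hL']
    exact ⟨by simp, by simpa using zetaTop_zero_excess (t + 1)⟩
  · obtain rfl : a = 0 := hone a (by linarith [hy2.resolve_right hy])
    have h3 : ((s : ℝ) - t) * r ^ 2 = 0 := by linear_combination hy1.resolve_left hy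
    have h4 : (s : ℝ) = t := by linarith [(mul_eq_zero.1 h3).resolve_right hr2.ne']
    refine Or.inr ⟨by exact_mod_cast h4, ?_, ?_⟩
    · rw [hK']
      simpa using zetaTop_zero_excess (s + 1)
    · rw [hL']
      simp

theorem sum_pow_mul_sum_pow_le_of_one {r : ℝ} (h₀ : 0 < r) (h₁ : r < 1) {s m₁ m₂ m : ℕ}
    (hm : m₁ + m₂ = m) {K : Fin (s + 2) → ℕ} (hK : K ∈ thetaSeq (s + 2) m₁)
    {L : Fin 1 → ℕ} (hL : L ∈ thetaSeq 1 m₂) :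
    (∑ i, r ^ K i) * ∑ j, r ^ L j ≤ (∑ i, r ^ zetaTop (s + 2) (m + 1 - 2 * 1) i) *
        ∑ j, r ^ zeta 1 j ∧
      ((∑ i, r ^ K i) * ∑ j, r ^ L j = (∑ i, r ^ zetaTop (s + 2) (m + 1 - 2 * 1) i) *
          ∑ j, r ^ zeta 1 j →
        K = zetaTop (s + 2) (m + 1 - 2 * 1) ∧ L = zeta 1) := by
  obtain ⟨a, ha⟩ : ∃ a, m₁ = 2 * (s + 1) + 1 + a := by
    obtain ⟨a, -, ha⟩ := exists_excess hK
    exact ⟨_, ha.symm⟩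
  obtain ⟨b, hb⟩ : ∃ b, L 0 = b + 1 := Nat.exists_eq_add_of_le' (hL.2.1 0)
  have hm2 : L 0 = m₂ := by simpa using hL.2.2.1
  have hmt : m + 1 - 2 * 1 = 2 * (s + 1) + 1 + (a + b) := by omega
  rw [hmt]
  subst ha
  obtain ⟨hKle, hKeq⟩ := sum_pow_le_sum_pow_zetaTop h₀ h₁ hK
  have hKpos : 0 < ∑ i, r ^ K i :=
    Finset.sum_pos (fun i _ => pow_pos h₀ _) Finset.univ_nonempty
  have hz : zeta 1 0 = 1 := rfl
  simp only [Fin.sum_univ_one, hz, pow_one, hb, pow_succ r b]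
  rw [sum_pow_zetaTop] at hKle hKeq ⊢
  rw [pow_add r a b]
  have hwa : r ^ a ≤ 1 := pow_le_one₀ h₀.le h₁.le
  have hwb : r ^ b ≤ 1 := pow_le_one₀ h₀.le h₁.le
  have hy0 : 0 < r ^ b := pow_pos h₀ b
  have hr2 : 0 < r ^ 2 := by positivity
  set x := r ^ a
  set y := r ^ b
  set PK := ∑ i, r ^ K i
  set A : ℝ := (s + 1) * r ^ 2 + r
  have hA : 0 < A - r ^ 2 := by
    have : A - r ^ 2 = s * r ^ 2 + r := by ring
    rw [this]
    positivity
  -- A single backward path loses the full factor `y` with its excess, so moving the excess to `K`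
  -- gains unless `y = 1`.
  have hgap : (A - r ^ 2 * (1 - x * y)) * r - (A - r ^ 2 * (1 - x)) * (y * r) =
      r * ((1 - y) * (A - r ^ 2)) := by ring
  have hg : 0 ≤ r * ((1 - y) * (A - r ^ 2)) :=
    mul_nonneg h₀.le (mul_nonneg (by linarith) hA.le)
  have hyr : 0 < y * r := by positivity
  have hc : PK * (y * r) ≤ (A - r ^ 2 * (1 - x)) * (y * r) :=
    mul_le_mul_of_nonneg_right hKle hyr.le
  refine ⟨by linarith, fun heq => ?_⟩
  have hK' := hKeq (mul_right_cancel₀ hyr.ne' (by linarith))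
  have hy : r * ((1 - y) * (A - r ^ 2)) = 0 := by linarith
  rw [mul_eq_zero, or_iff_right h₀.ne', mul_eq_zero, or_iff_left hA.ne'] at hy
  obtain rfl : b = 0 := by
    by_contra hne
    have := pow_lt_one₀ h₀.le h₁ hne
    linarith
  refine ⟨by rw [hK']; simp, ?_⟩
  ext j
  obtain rfl := Subsingleton.elim j 0
  rw [hb, hz]

theorem sum_pow_zeta_mul_le {r : ℝ} (h₀ : 0 < r) (h₁ : r < 1) {s m₁ m₂ m : ℕ}
    (hm : m₁ + m₂ = m) {K : Fin (s + 2) → ℕ} (hK : K ∈ thetaSeq (s + 2) m₁)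
    {L : Fin 1 → ℕ} (hL : L ∈ thetaSeq 1 m₂) :
    (∑ i, r ^ zeta (s + 2) i) * ∑ _j : Fin 1, r ^ (m + 1 - 2 * (s + 2)) ≤
        (∑ i, r ^ K i) * ∑ j, r ^ L j ∧
      ((∑ i, r ^ zeta (s + 2) i) * ∑ _j : Fin 1, r ^ (m + 1 - 2 * (s + 2)) =
          (∑ i, r ^ K i) * ∑ j, r ^ L j →
        K = zeta (s + 2) ∧ L = fun _ => m + 1 - 2 * (s + 2)) := by
  obtain ⟨a, ha, hsum⟩ := exists_excess hK
  have hm2 : L 0 = m₂ := by simpa using hL.2.2.1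
  have hmt : m + 1 - 2 * (s + 2) = ∑ i, a i + L 0 := by omega
  rw [hmt]
  simp only [Fin.sum_univ_one, Finset.sum_mul, ← pow_add]
  have hexp : ∀ i, K i + L 0 ≤ zeta (s + 2) i + (∑ i, a i + L 0) := by
    intro i
    have := Finset.single_le_sum (fun j _ => Nat.zero_le (a j)) (Finset.mem_univ i)
    have hai : K i = zeta (s + 2) i + a i := ha i
    omega
  have hterm : ∀ i ∈ Finset.univ, r ^ (zeta (s + 2) i + (∑ i, a i + L 0)) ≤ r ^ (K i + L 0) :=
    fun i _ => pow_le_pow_of_le_one h₀.le h₁.le (hexp i)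
  refine ⟨Finset.sum_le_sum hterm, fun heq => ?_⟩
  -- Equality holds term by term, so each entry carries the whole excess of `K`; with at least two
  -- entries that excess is zero.
  have hall : ∀ i, a i = ∑ i, a i := by
    intro i
    have h := (Finset.sum_eq_sum_iff_of_le hterm).1 heq i (Finset.mem_univ _)
    have h' := pow_right_injective₀ h₀ h₁.ne h
    have hai : K i = zeta (s + 2) i + a i := ha i
    omega
  have hzero : ∑ i, a i = 0 := by
    have h0 := hall 0
    have h1 := hall (Fin.succ 0)
    rw [Fin.sum_univ_succ, Fin.sum_univ_succ] at h0 h1 ⊢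
    omega
  constructor
  · ext i
    rw [ha i, hall i, hzero, add_zero]
  · ext j
    obtain rfl := Subsingleton.elim j 0
    rw [hzero, zero_add]

/-! ### Uniqueness of the extremal digraphs. -/

theorem const_mem_thetaSeq_one {n : ℕ} (hn : 1 ≤ n) : (fun _ => n : Fin 1 → ℕ) ∈ thetaSeq 1 n :=
  ⟨fun _ _ _ => le_rfl, fun _ => hn, by simp, fun i hi => by omega⟩

theorem IsThetaDigraph.iso_of_one_one {m m₁ m₂ : ℕ} (hm : m₁ + m₂ = m) {K L : Fin 1 → ℕ}
    (hK : K ∈ thetaSeq 1 m₁) (hL : L ∈ thetaSeq 1 m₂) {V : Type*} {G : Digraph V}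
    (hG : IsThetaDigraph 1 1 m G) : DigraphIso G (thetaDigraph K L) := by
  obtain ⟨n₁, n₂, hn, K', hK', L', hL', e⟩ := hG
  have e1 : K 0 = m₁ := by simpa using hK.2.2.1
  have e2 : L 0 = m₂ := by simpa using hL.2.2.1
  have e3 : K' 0 = n₁ := by simpa using hK'.2.2.1
  have e4 : L' 0 = n₂ := by simpa using hL'.2.2.1
  exact e.trans (DigraphIso.thetaDigraph_cycle (hK'.2.1 0) (hL'.2.1 0) (hK.2.1 0) (hL.2.1 0)
    (by omega))

theorem isUniqueThetaMaximizer_zetaTop {α : ℝ} (h₀ : 0 ≤ α) (h₁ : α < 1) {s t m : ℕ}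
    (hst : t ≤ s) (hm : 2 * (s + 1 + (t + 1)) - 2 ≤ m) :
    IsUniqueThetaMaximizer.{w} α (s + 1) (t + 1) m
      (thetaDigraph (zetaTop (s + 1) (m + 1 - 2 * (t + 1))) (zeta (t + 1))) := by
  have hKmem : zetaTop (s + 1) (m + 1 - 2 * (t + 1)) ∈
      thetaSeq (s + 1) (m + 1 - 2 * (t + 1)) := by
    obtain ⟨a, ha⟩ := Nat.exists_eq_add_of_le
      (show 2 * s + 1 ≤ m + 1 - 2 * (t + 1) by omega)
    rw [ha]
    exact zetaTop_mem_thetaSeq s a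
  have hLmem := zeta_mem_thetaSeq t
  have hsum : m + 1 - 2 * (t + 1) + (2 * t + 1) = m := by omega
  refine ⟨⟨_, _, hsum, _, hKmem, _, hLmem, DigraphIso.refl _⟩, fun {V} _ G hG => ?_⟩
  -- One path in each direction: the root is `r = 1`, so the comparison on `(0, 1)` does not apply,
  -- but there is only one isomorphism class.
  rcases s with _ | s
  · obtain rfl : t = 0 := by omega
    have e := hG.iso_of_one_one hsum hKmem hLmem
    exact ⟨(alphaSpectralRadius_congr α e).le, fun _ => e⟩
  obtain ⟨m₁, m₂, hm', K, hK, L, hL, e⟩ := hG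
  rw [alphaSpectralRadius_congr α e]
  rcases t with _ | t
  · obtain ⟨c1, c2⟩ := alphaSpectralRadius_thetaDigraph_compare h₀ h₁ le_rfl (by omega)
      (by omega) hK hL hKmem hLmem
      fun r hr0 hr1 => (sum_pow_mul_sum_pow_le_of_one hr0 hr1 hm' hK hL).1
    refine ⟨c1, fun heq => ?_⟩
    obtain ⟨r, hr0, hr1, hr⟩ := c2 heq
    obtain ⟨rfl, rfl⟩ := (sum_pow_mul_sum_pow_le_of_one hr0 hr1 hm' hK hL).2 hr
    exact e
  · obtain ⟨c1, c2⟩ := alphaSpectralRadius_thetaDigraph_compare h₀ h₁ (by omega) (by omega)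
      (by omega) hK hL hKmem hLmem
      fun r hr0 hr1 => (sum_pow_mul_sum_pow_le_of_two_le hr0 hr1 (by omega) hm' hK hL).1
    refine ⟨c1, fun heq => ?_⟩
    obtain ⟨r, hr0, hr1, hr⟩ := c2 heq
    rcases (sum_pow_mul_sum_pow_le_of_two_le hr0 hr1 (by omega) hm' hK hL).2 hr with
      ⟨rfl, rfl⟩ | ⟨rfl, rfl, rfl⟩
    · exact e
    · exact e.trans (DigraphIso.thetaDigraph_swap _ _)

theorem isUniqueThetaMinimizer_zeta {α : ℝ} (h₀ : 0 ≤ α) (h₁ : α < 1) {s m : ℕ}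
    (hm : 2 * (s + 1 + 1) - 2 ≤ m) :
    IsUniqueThetaMinimizer.{w} α (s + 1) 1 m
      (thetaDigraph (zeta (s + 1)) (fun _ : Fin 1 => m + 1 - 2 * (s + 1))) := by
  have hKmem := zeta_mem_thetaSeq s
  have hLmem := const_mem_thetaSeq_one (n := m + 1 - 2 * (s + 1)) (by omega)
  have hsum : 2 * s + 1 + (m + 1 - 2 * (s + 1)) = m := by omega
  refine ⟨⟨_, _, hsum, _, hKmem, _, hLmem, DigraphIso.refl _⟩, fun {V} _ G hG => ?_⟩
  rcases s with _ | s
  · have e := hG.iso_of_one_one hsum hKmem hLmem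
    exact ⟨(alphaSpectralRadius_congr α e).ge, fun _ => e⟩
  obtain ⟨m₁, m₂, hm', K, hK, L, hL, e⟩ := hG
  rw [alphaSpectralRadius_congr α e]
  obtain ⟨c1, c2⟩ := alphaSpectralRadius_thetaDigraph_compare h₀ h₁ le_rfl (by omega)
    (by omega) hKmem hLmem hK hL
    fun r hr0 hr1 => (sum_pow_zeta_mul_le hr0 hr1 hm' hK hL).1
  refine ⟨c1, fun heq => ?_⟩
  obtain ⟨r, hr0, hr1, hr⟩ := c2 heq.symm
  obtain ⟨rfl, rfl⟩ := (sum_pow_zeta_mul_le hr0 hr1 hm' hK hL).2 hr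
  exact e

/-- For `t = 1` one has `k = s + 1`, so `m + 1 - 2 * s` is `m - 2k + 3`; the bound on `m` keeps it
positive. -/
theorem mainTheorem5 (α : ℝ) (hα₀ : 0 ≤ α) (hα₁ : α < 1)
    (s t k m : ℕ) (ht : 1 ≤ t) (hst : t ≤ s) (hk : s + t = k) (hm : 2 * k - 2 ≤ m) :
    IsUniqueThetaMaximizer.{w} α s t m (thetaDigraph (zetaTop s (m + 1 - 2 * t)) (zeta t)) ∧
    (t = 1 →
      IsUniqueThetaMinimizer.{w} α s t m
        (thetaDigraph (zeta s) (fun _ : Fin t => m + 1 - 2 * s))) := by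
  subst hk
  obtain ⟨s, rfl⟩ := Nat.exists_eq_add_of_le' (ht.trans hst)
  obtain ⟨t, rfl⟩ := Nat.exists_eq_add_of_le' ht
  refine ⟨isUniqueThetaMaximizer_zetaTop hα₀ hα₁ (by omega) hm, fun h => ?_⟩
  obtain rfl : t = 0 := by omega
  exact isUniqueThetaMinimizer_zeta hα₀ hα₁ hm
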